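/- Let $K$ be a field of characteristic zero. A Lie algebra $\mathfrak{G}$ over $K$ (of arbitrary, possibly infinite, dimension) is called weakly Noetherian if $\dim_K \mathfrak{h}/[\mathfrak{h},\mathfrak{h}]<\infty$ for every Lie subalgebra $\mathfrak{h}\subset\mathfrak{G}$. The centroid of a Lie algebra $\mathfrak{s}$ over $K$ is the algebra $\mathrm{Cent}(\mathfrak{s})=\{\theta\in\mathrm{End}_K(\mathfrak{s}) \mid \theta([x,y])=[x,\theta(y)] \text{ for all } x,y\in\mathfrak{s}\}$, which acts on $\mathfrak{s}$ by evaluation. A Lie algebra is simple if it is nonabelian and has no ideals other than $0$ and itself; in that case its centroid is a division algebra (in fact a field). Theorem. Let $\mathfrak{G}$ be a weakly Noetherian Lie algebra over $K$ and let $d>1$ be an integer. Then $\mathfrak{G}$ contains only finitely many maximal ideals $\mathfrak{m}$ such that $\mathfrak{G}/\mathfrak{m}$ is a simple Lie algebra of dimension $d$ over its centroid $L=\mathrm{Cent}(\mathfrak{G}/\mathfrak{m})$. -/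

import Mathlib

namespace LieAlgebra

/-- A Lie algebra `L` over a field `K` is weakly Noetherian if `𝔥 / [𝔥, 𝔥]` is finite dimensional
over `K` for every Lie subalgebra `𝔥` of `L`. -/
def IsWeaklyNoetherian (K L : Type*) [Field K] [LieRing L] [LieAlgebra K L] : Prop :=
  ∀ 𝔥 : LieSubalgebra K L,
    FiniteDimensional K (𝔥 ⧸ ⁅(⊤ : LieIdeal K 𝔥), (⊤ : LieIdeal K 𝔥)⁆)

/-- The centroid of a Lie algebra `L`: the associative algebra of all `K`-linear endomorphisms `θ`
of `L` such that `θ [x, y] = [x, θ y]` for all `x, y`. It acts on `L` by evaluation. -/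
def centroid (K L : Type*) [Field K] [LieRing L] [LieAlgebra K L] :
    Subalgebra K (Module.End K L) where
  carrier := {θ | ∀ x y : L, θ ⁅x, y⁆ = ⁅x, θ y⁆}
  mul_mem' := by
    intro a b ha hb x y
    simp only [Set.mem_ofPred_eq] at ha hb
    rw [Module.End.mul_apply, Module.End.mul_apply, hb, ha]
  add_mem' := by
    intro a b ha hb x y
    simp only [Set.mem_ofPred_eq] at ha hb
    rw [LinearMap.add_apply, LinearMap.add_apply, ha, hb, lie_add]
  algebraMap_mem' := by
    intro r x y
    simp only [Module.algebraMap_end_apply, lie_smul]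

end LieAlgebra

open Module

/-! Each quotient is central simple of dimension d over its centroid, so by density the operators
generated by ad form its full matrix algebra. For an index i, some alternating polynomial in d
variables, evaluated in G, gives v nonzero at i. Applying an operator u to all d variables
multiplies the value at every index k by det(u_k) (`exists_det_smul_mem`). These values are
componentwise proportional to v, hence commute in the product of the quotients, and weak
Noetherianity makes their span finite dimensional. Operators can be made 1 at one index and 0 at
finitely many others, so v has finite support, and then support {i}. The resulting vectors, one per
index, commute and are independent, so there are finitely many indices. -/

/-- An alternating map in `finrank` many variables transforms under an endomorphism by its
determinant. -/
theorem AlternatingMap.map_comp_eq_det_smul {F V W : Type*} [Field F] [AddCommGroup V] [Module F V]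
    [FiniteDimensional F V] [AddCommGroup W] [Module F W] {n : ℕ} (hn : finrank F V = n)
    (f : V [⋀^Fin n]→ₗ[F] W) (T : End F V) (x : Fin n → V) :
    f (fun j => T (x j)) = LinearMap.det T • f x := by
  let b : Basis (Fin n) F V := finBasisOfFinrankEq F V hn
  rw [← sub_eq_zero, ← Module.forall_dual_apply_eq_zero_iff F]
  intro φ
  have key (y : Fin n → V) : φ (f y) = φ (f b) * b.det y := by
    simpa using congrArg (fun g => g y) ((φ.compAlternatingMap f).eq_smul_basis_det b)
  have hdet := b.det_comp T x
  rw [map_sub, map_smul, key, key x, smul_eq_mul, sub_eq_zero]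
  change _ * b.det (⇑T ∘ x) = _
  rw [hdet]
  ring

namespace LieAlgebra

/-- In a weakly Noetherian Lie algebra, a space of vectors in a linear image which is abelian,
in the sense that brackets of preimages vanish in the image, is finite dimensional. -/
theorem IsWeaklyNoetherian.finiteDimensional_of_abelian {K G E : Type*} [Field K] [LieRing G]
    [LieAlgebra K G] (hG : IsWeaklyNoetherian K G) [AddCommGroup E] [Module K E] (φ : G →ₗ[K] E)
    (V : Submodule K E) (hV : V ≤ LinearMap.range φ)
    (hab : ∀ x y : G, φ x ∈ V → φ y ∈ V → φ ⁅x, y⁆ = 0) : FiniteDimensional K V := by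
  -- The preimage of V surjects onto V through its abelianization.
  let H : LieSubalgebra K G :=
    { V.comap φ with
      lie_mem' := by
        intro x y hx hy
        change φ ⁅x, y⁆ ∈ V
        rw [hab x y hx hy]
        exact V.zero_mem }
  let ψ : H →ₗ[K] V := LinearMap.codRestrict V (φ ∘ₗ H.toSubmodule.subtype) (fun x => x.2)
  have hle : (⁅(⊤ : LieIdeal K H), (⊤ : LieIdeal K H)⁆ : LieIdeal K H).toSubmodule ≤
      LinearMap.ker ψ := by
    rw [LieSubmodule.lieIdeal_oper_eq_linear_span', Submodule.span_le]
    rintro _ ⟨x, -, y, -, rfl⟩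
    exact Subtype.ext (hab x y x.2 y.2)
  have := hG H
  refine Module.Finite.of_surjective
    (Submodule.liftQ (⁅(⊤ : LieIdeal K H), (⊤ : LieIdeal K H)⁆ : LieIdeal K H).toSubmodule ψ hle) ?_
  rintro ⟨v, hv⟩
  obtain ⟨x, rfl⟩ := hV hv
  exact ⟨Submodule.Quotient.mk ⟨x, hv⟩, rfl⟩

/-! ### Multiplication operators via the free associative algebra -/

section FreeAd

variable {K G s L : Type*} [Field K] [LieRing G] [LieAlgebra K G] [Field L] [Algebra K L]
  [LieRing s] [LieAlgebra L s] [Module K s] [IsScalarTower K L s]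

/-- The action on `s` of the free associative algebra on `G`, where `g` acts by `ad (p g)`. -/
noncomputable def freeAd (p : G →ₗ[K] s) :
    FreeAlgebra K G →ₐ[K] End L s :=
  FreeAlgebra.lift K (fun g => LieAlgebra.ad L s (p g))

@[simp]
theorem freeAd_ι (p : G →ₗ[K] s) (g : G) :
    freeAd (L := L) p (FreeAlgebra.ι K g) = LieAlgebra.ad L s (p g) := by
  simp [freeAd]

/-- Lets one operator on G induce the corresponding operators in all quotients at once. -/
theorem map_freeAd (p : G →ₗ[K] s)
    (hp : ∀ x y, p ⁅x, y⁆ = ⁅p x, p y⁆) (u : FreeAlgebra K G) (x : G) :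
    p (freeAd (L := K) (LinearMap.id : G →ₗ[K] G) u x) = freeAd (L := L) p u (p x) := by
  induction u using FreeAlgebra.induction generalizing x with
  | grade0 r => simp [AlgHom.commutes, Module.algebraMap_end_apply]
  | grade1 g => simp [hp]
  | mul a b ha hb => simp [ha, hb]
  | add a b ha hb => simp [ha, hb]

end FreeAd

/-! ### Alternating polynomials and determinants -/

section Family

attribute [local instance] LieRing.ofAssociativeRing

variable {K G ι : Type*} [Field K] [LieRing G] [LieAlgebra K G]
  {L s : ι → Type*} [∀ i, Field (L i)] [∀ i, Algebra K (L i)] [∀ i, LieRing (s i)]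
  [∀ i, LieAlgebra (L i) (s i)] [∀ i, Module K (s i)] [∀ i, IsScalarTower K (L i) (s i)]
  (π : ∀ i, G →ₗ[K] s i)

/-- A family of `L k`-linear maps `s k → End (s k)` is realizable if it is induced by a single map
from `G` to the free associative algebra on `G`. -/
def IsRealizable (q : ∀ k, s k →ₗ[L k] End (L k) (s k)) : Prop :=
  ∃ r : G → FreeAlgebra K G, ∀ k x, freeAd (L := L k) (π k) (r x) = q k (π k x)

variable {π}

/-- With P = l ⊗ e and Q = μ ⊗ v at i, the product P (ad z) Q equals l([z, v]) μ ⊗ e. The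
functionals z ↦ l([z, v]) have only central common zeros, so they span the dual. -/
theorem exists_isRealizable_eq_smul (i : ι) [FiniteDimensional (L i) (s i)]
    (hdens : Function.Surjective (freeAd (L := L i) (π i)))
    (hcenter : ∀ z : s i, (∀ w : s i, ⁅z, w⁆ = 0) → z = 0)
    (e : s i) (μ : Dual (L i) (s i)) (α : Dual (L i) (s i)) :
    ∃ q : ∀ k, s k →ₗ[L k] End (L k) (s k), IsRealizable π q ∧
      ∀ z, q i z = α z • μ.smulRight e := by
  have hspan : Submodule.span (L i) (Set.range fun p : Dual (L i) (s i) × s i =>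
      (p.1 ∘ₗ (-(LieAlgebra.ad (L i) (s i) p.2 : End (L i) (s i))) : Dual (L i) (s i))) = ⊤ := by
    apply Submodule.span_eq_top_of_ne_zero
    intro z hz
    by_contra! hc
    refine hz (hcenter z fun w => ?_)
    rw [← Module.forall_dual_apply_eq_zero_iff (L i)]
    intro l
    rw [← lie_skew, map_neg, neg_eq_zero]
    simpa using hc _ ⟨(l, w), rfl⟩
  have hα : α ∈ Submodule.span (L i) (Set.range fun p : Dual (L i) (s i) × s i =>
      (p.1 ∘ₗ (-(LieAlgebra.ad (L i) (s i) p.2 : End (L i) (s i))) : Dual (L i) (s i))) :=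
    hspan ▸ Submodule.mem_top
  induction hα using Submodule.span_induction with
  | mem α h =>
    obtain ⟨⟨l, v⟩, rfl⟩ := h
    obtain ⟨P, hP⟩ := hdens (l.smulRight e)
    obtain ⟨Q, hQ⟩ := hdens (μ.smulRight v)
    refine ⟨fun k => LinearMap.mulLeft (L k) (freeAd (L := L k) (π k) P) ∘ₗ
      LinearMap.mulRight (L k) (freeAd (L := L k) (π k) Q) ∘ₗ
        (LieAlgebra.ad (L k) (s k)).toLinearMap,
      ⟨fun x => P * (FreeAlgebra.ι K x * Q), fun k x => by simp⟩, fun z => ?_⟩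
    ext w
    have h : l ⁅z, v⁆ = -l ⁅v, z⁆ := by rw [← lie_skew, map_neg]
    simp [hP, hQ, smul_smul, mul_comm, h]
  | zero => exact ⟨0, ⟨0, by simp⟩, by simp⟩
  | add α β _ _ h₁ h₂ =>
    obtain ⟨q₁, ⟨r₁, h₁⟩, e₁⟩ := h₁
    obtain ⟨q₂, ⟨r₂, h₂⟩, e₂⟩ := h₂
    exact ⟨q₁ + q₂, ⟨r₁ + r₂, by simp [h₁, h₂]⟩, by simp [e₁, e₂, add_smul]⟩
  | smul c α _ h =>
    obtain ⟨q, ⟨r, h⟩, e⟩ := h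
    obtain ⟨P, hP⟩ := hdens (c • 1)
    refine ⟨fun k => LinearMap.mulLeft (L k) (freeAd (L := L k) (π k) P) ∘ₗ q k,
      ⟨fun x => P * r x, by simp [h]⟩, fun z => ?_⟩
    simp [hP, e, smul_smul, mul_comm]

/-- For each index there is a vector nonzero there, all of whose multiples by a determinant
of an element of the free associative algebra lie in the image of `G`. -/
theorem exists_det_smul_mem {d : ℕ} (hd : 0 < d) (hfin : ∀ k, finrank (L k) (s k) = d)
    (hsurj : ∀ k, Function.Surjective (π k)) (hlie : ∀ k x y, π k ⁅x, y⁆ = ⁅π k x, π k y⁆) (i : ι)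
    (hdens : Function.Surjective (freeAd (L := L i) (π i)))
    (hcenter : ∀ z : s i, (∀ w : s i, ⁅z, w⁆ = 0) → z = 0) :
    ∃ v : G, π i v ≠ 0 ∧ ∀ u : FreeAlgebra K G, ∃ w : G, ∀ k,
      π k w = LinearMap.det (freeAd (L := L k) (π k) u) • π k v := by
  have hfd (k) : FiniteDimensional (L k) (s k) := .of_finrank_pos (by rw [hfin]; exact hd)
  obtain ⟨act, hmap⟩ : ∃ act : FreeAlgebra K G → G → G,
      ∀ k u x, π k (act u x) = freeAd (L := L k) (π k) u (π k x) :=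
    ⟨fun u => freeAd (L := K) (LinearMap.id : G →ₗ[K] G) u,
      fun k => map_freeAd (L := L k) (π k) (hlie k)⟩
  let b : Module.Basis (Fin d) (L i) (s i) := finBasisOfFinrankEq _ _ (hfin i)
  let μ := b.coord ⟨0, hd⟩
  let e := b ⟨0, hd⟩
  have hE : ∀ n : ℕ, (μ.smulRight e ^ n : End (L i) (s i)) e = e := by
    intro n
    induction n with
    | zero => simp
    | succ n ih => rw [pow_succ, Module.End.mul_apply]; simp [μ, e] at ih ⊢; exact ih
  choose q hq hqi using fun j => exists_isRealizable_eq_smul i hdens hcenter e μ (b.coord j)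
  choose r hr using hq
  -- At i, `q j` sends z to its j-th coordinate times the idempotent μ ⊗ e; `f` induces `F k` at
  -- every k.
  let F (k : ι) : s k [⋀^Fin d]→ₗ[L k] End (L k) (s k) :=
    MultilinearMap.alternatization
      ((MultilinearMap.mkPiAlgebraFin (L k) d (End (L k) (s k))).compLinearMap fun j => q j k)
  let f (x : Fin d → G) : FreeAlgebra K G :=
    ∑ σ : Equiv.Perm (Fin d), Equiv.Perm.sign σ • (List.ofFn fun j => r j (x (σ j))).prod
  have hF (k : ι) (x : Fin d → G) : freeAd (L := L k) (π k) (f x) = F k (fun j => π k (x j)) := by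
    simp only [F, f, MultilinearMap.alternatization_apply, map_sum]
    refine Finset.sum_congr rfl fun σ _ => ?_
    simp only [Units.smul_def, map_zsmul, map_list_prod, List.map_ofFn]
    congr 2
    simp [Function.comp_def, hr]
  choose x hx using fun j => hsurj i (b j)
  obtain ⟨y, hy⟩ := hsurj i e
  have hact (k : ι) (x : Fin d → G) :
      π k (act (f x) y) =
        F k (fun j => π k (x j)) (π k y) := by
    rw [hmap, hF]
  refine ⟨act (f x) y, ?_, fun u =>
    ⟨act
      (f fun j => act u (x j)) y, fun k => ?_⟩⟩
  · rw [hact, hy]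
    simp only [hx, F, MultilinearMap.alternatization_apply]
    -- On the basis, a permutation moving some j contributes a factor `b.coord j (b (σ j)) = 0`.
    rw [Finset.sum_eq_single 1]
    · have h := hE d
      simp only [MultilinearMap.domDomCongr_apply, MultilinearMap.compLinearMap_apply, hqi]
      simpa [MultilinearMap.mkPiAlgebraFin_apply, List.ofFn_const, h] using b.ne_zero _
    · intro σ _ hσ
      obtain ⟨j, hj⟩ : ∃ j, σ j ≠ j := by
        by_contra! h
        exact hσ (Equiv.ext h)
      rw [MultilinearMap.domDomCongr_apply, MultilinearMap.compLinearMap_apply,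
        (MultilinearMap.mkPiAlgebraFin _ _ _).map_coord_zero j, smul_zero]
      rw [hqi, Module.Basis.coord_apply, Module.Basis.repr_self, Finsupp.single_eq_of_ne (Ne.symm hj), zero_smul]
    · simp
  · rw [hact]
    rw [hact k (fun j => act u (x j))]
    simp only [hmap]
    rw [(F k).map_comp_eq_det_smul (hfin k), LinearMap.smul_apply]

end Family

/-! ### Separation of indices and the finiteness count -/

section Family

attribute [local instance] LieRing.ofAssociativeRing

variable {K G ι : Type*} [Field K] [LieRing G] [LieAlgebra K G]
  {L s : ι → Type*} [∀ i, Field (L i)] [∀ i, Algebra K (L i)] [∀ i, LieRing (s i)]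
  [∀ i, LieAlgebra (L i) (s i)] [∀ i, Module K (s i)] [∀ i, IsScalarTower K (L i) (s i)]
  {π : ∀ i, G →ₗ[K] s i}

/-- Elements of the free associative algebra separate any index from finitely many others. -/
theorem exists_freeAd_eq_one_and_eq_zero (i : ι) [FiniteDimensional (L i) (s i)]
    (hdens : Function.Surjective (freeAd (L := L i) (π i)))
    (hcenter : ∀ z : s i, (∀ w : s i, ⁅z, w⁆ = 0) → z = 0)
    (hsep : ∀ k, k ≠ i → ∃ g, π k g = 0 ∧ π i g ≠ 0) (J : Finset ι) (hJ : i ∉ J) :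
    ∃ u, freeAd (L := L i) (π i) u = 1 ∧ ∀ k ∈ J, freeAd (L := L k) (π k) u = 0 := by
  classical
  induction J using Finset.induction_on with
  | empty => exact ⟨1, by simp⟩
  | insert k J _ ih =>
    simp only [Finset.mem_insert, not_or] at hJ
    obtain ⟨u, hu, huJ⟩ := ih hJ.2
    obtain ⟨g, hg, hgi⟩ := hsep k (Ne.symm hJ.1)
    obtain ⟨w, hw⟩ : ∃ w : s i, ⁅π i g, w⁆ ≠ 0 := by
      by_contra! h
      exact hgi (hcenter _ h)
    obtain ⟨l, hl⟩ : ∃ l : Dual (L i) (s i), l ⁅π i g, w⁆ = 1 := by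
      obtain ⟨l, hl⟩ := not_forall.1
        (mt (Module.forall_dual_apply_eq_zero_iff (L i) ⁅π i g, w⁆).1 hw)
      exact ⟨(l ⁅π i g, w⁆)⁻¹ • l, by simp [hl]⟩
    let b := finBasis (L i) (s i)
    choose P hP using fun j => hdens (l.smulRight (b j))
    choose Q hQ using fun j => hdens ((b.coord j).smulRight w)
    -- At i the j-th summand is the matrix unit E_jj; at k the middle factor ad g is zero.
    refine ⟨u * ∑ j, P j * FreeAlgebra.ι K g * Q j, ?_, ?_⟩
    · have h1 (j) : freeAd (L := L i) (π i) (P j * FreeAlgebra.ι K g * Q j) =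
          (b.coord j).smulRight (b j) := by
        ext z
        simp [hP, hQ, hl]
      rw [map_mul, hu, one_mul, map_sum]
      ext z
      simp only [h1, LinearMap.sum_apply, LinearMap.smulRight_apply, Module.Basis.coord_apply,
        b.sum_repr, Module.End.one_apply]
    · intro k' hk'
      rcases Finset.mem_insert.1 hk' with rfl | hk'
      · simp [hg]
      · rw [map_mul, huJ k' hk', zero_mul]

theorem linearIndependent_pi_of_separated {K κ ι : Type*} [Field K] {s : ι → Type*}
    [∀ k, AddCommGroup (s k)] [∀ k, Module K (s k)] (w : κ → ∀ k, s k) (σ : κ → ι)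
    (hne : ∀ j, w j (σ j) ≠ 0) (hzero : ∀ j j', j' ≠ j → w j' (σ j) = 0) :
    LinearIndependent K w := by
  rw [linearIndependent_iff']
  intro J c hc j hj
  have hc' := congrFun hc (σ j)
  rw [Finset.sum_apply, Finset.sum_eq_single_of_mem j hj fun k _ hk => by
    rw [Pi.smul_apply, hzero j k hk, smul_zero]] at hc'
  exact (smul_eq_zero.1 hc').resolve_right (hne j)

/-- In a weakly Noetherian Lie algebra, vectors whose images are everywhere proportional to a
fixed vector span a finite-dimensional space. -/
theorem IsWeaklyNoetherian.finiteDimensional_span_of_proportional (hG : IsWeaklyNoetherian K G)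
    (hlie : ∀ k x y, π k ⁅x, y⁆ = ⁅π k x, π k y⁆) {κ : Type*} (w : κ → G) (z : ∀ k, s k)
    (hw : ∀ j k, ∃ c : L k, π k (w j) = c • z k) :
    FiniteDimensional K (Submodule.span K (Set.range fun j => LinearMap.pi π (w j))) := by
  refine hG.finiteDimensional_of_abelian (LinearMap.pi π) _ ?_ ?_
  · rw [Submodule.span_le]
    rintro _ ⟨j, rfl⟩
    exact ⟨w j, rfl⟩
  · have hV (x : ∀ k, s k)
        (hx : x ∈ Submodule.span K (Set.range fun j => LinearMap.pi π (w j))) (k) :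
        ∃ c : L k, x k = c • z k := by
      induction hx using Submodule.span_induction with
      | mem x h => obtain ⟨j, rfl⟩ := h; exact hw j k
      | zero => exact ⟨0, (zero_smul _ _).symm⟩
      | add x y _ _ hx hy =>
        obtain ⟨a, ha⟩ := hx
        obtain ⟨c, hc⟩ := hy
        exact ⟨a + c, by rw [Pi.add_apply, ha, hc, add_smul]⟩
      | smul a x _ hx =>
        obtain ⟨c, hc⟩ := hx
        exact ⟨a • c, by rw [Pi.smul_apply, hc, smul_assoc]⟩
    intro x y hx hy
    ext k
    obtain ⟨a, ha⟩ := hV _ hx k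
    obtain ⟨c, hc⟩ := hV _ hy k
    rw [LinearMap.pi_apply] at ha hc
    rw [LinearMap.pi_apply, hlie, ha, hc, smul_lie, lie_smul, lie_self, smul_zero, smul_zero,
      Pi.zero_apply]

theorem IsWeaklyNoetherian.finite_index (hG : IsWeaklyNoetherian K G) {d : ℕ} (hd : 0 < d)
    (hfin : ∀ k, finrank (L k) (s k) = d)
    (hsurj : ∀ k, Function.Surjective (π k)) (hlie : ∀ k x y, π k ⁅x, y⁆ = ⁅π k x, π k y⁆)
    (hdens : ∀ i, Function.Surjective (freeAd (L := L i) (π i)))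
    (hcenter : ∀ i, ∀ z : s i, (∀ w : s i, ⁅z, w⁆ = 0) → z = 0)
    (hsep : ∀ i k, k ≠ i → ∃ g, π k g = 0 ∧ π i g ≠ 0) : Finite ι := by
  classical
  have hfd (k) : FiniteDimensional (L k) (s k) := .of_finrank_pos (by rw [hfin]; exact hd)
  have hdet (k) : LinearMap.det (0 : End (L k) (s k)) = 0 := by
    simp [LinearMap.det_zero, hfin, hd.ne']
  have key (i) : ∃ v : G, π i v ≠ 0 ∧ ∀ k, k ≠ i → π k v = 0 := by
    obtain ⟨v, hv, hw⟩ := exists_det_smul_mem hd hfin hsurj hlie i (hdens i) (hcenter i)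
    choose w hw using hw
    have hsupp : {k | π k v ≠ 0}.Finite := by
      by_contra hinf
      have hV := hG.finiteDimensional_span_of_proportional hlie w (fun k => π k v)
        fun u k => ⟨_, hw u k⟩
      set V := Submodule.span K (Set.range fun u => LinearMap.pi π (w u)) with hVdef
      -- One more index than dim V: the separating operators would give that many independent
      -- vectors in V.
      obtain ⟨J, hJ, hcard⟩ := Set.Infinite.exists_subset_card_eq hinf (finrank K V + 1)
      have hu (j : J) := exists_freeAd_eq_one_and_eq_zero j.1 (hdens j) (hcenter j) (hsep j)
        (J.erase j) (by simp)
      choose u hu hu' using hu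
      have hli : LinearIndependent K (fun j : J =>
          (⟨LinearMap.pi π (w (u j)), Submodule.subset_span ⟨u j, rfl⟩⟩ : V)) := by
        refine LinearIndependent.of_comp V.subtype
          (linearIndependent_pi_of_separated _ Subtype.val (fun j => ?_) fun j j' hj => ?_)
        · change π j (w (u j)) ≠ 0
          rw [hw, hu, map_one, one_smul]
          exact hJ j.2
        · change π j (w (u j')) = 0
          rw [hw, hu' j' j (Finset.mem_erase.2 ⟨fun h => hj (Subtype.ext h.symm), j.2⟩), hdet,
            zero_smul]
      have := hli.fintype_card_le_finrank
      rw [Fintype.card_coe, hcard] at this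
      omega
    obtain ⟨u, hu, hu'⟩ := exists_freeAd_eq_one_and_eq_zero i (hdens i) (hcenter i) (hsep i)
      (hsupp.toFinset.erase i) (by simp)
    refine ⟨w u, by rwa [hw, hu, map_one, one_smul], fun k hk => ?_⟩
    rw [hw]
    by_cases h : π k v = 0
    · rw [h, smul_zero]
    · rw [hu' k (by simp [hk, h]), hdet, zero_smul]
  choose v hv hv' using key
  -- The common direction is the diagonal vector k ↦ `π k (v k)`; each `v i` is its i-th component.
  have hV := hG.finiteDimensional_span_of_proportional (L := L) hlie v (fun k => π k (v k)) fun i k => by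
    by_cases hik : k = i
    · subst hik; exact ⟨1, (one_smul _ _).symm⟩
    · exact ⟨0, by rw [hv' i k hik, zero_smul]⟩
  have hli : LinearIndependent K (fun i => (⟨LinearMap.pi π (v i),
      Submodule.subset_span ⟨i, rfl⟩⟩ :
        Submodule.span K (Set.range fun i => LinearMap.pi π (v i)))) :=
    LinearIndependent.of_comp (Submodule.subtype _)
      (linearIndependent_pi_of_separated _ id hv fun j j' hj => hv' j' j hj.symm)
  exact hli.finite

end Family

/-! ### Simple Lie algebras, centroids and density -/

theorem IsSimple.eq_zero_of_forall_lie_eq_zero {K S : Type*} [Field K] [LieRing S]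
    [LieAlgebra K S] [IsSimple K S] (z : S) (hz : ∀ w : S, ⁅z, w⁆ = 0) : z = 0 := by
  have : z ∈ LieAlgebra.center K S := by
    rw [LieModule.mem_maxTrivSubmodule]
    intro w
    rw [← lie_skew, hz, neg_zero]
  rcases IsSimple.eq_bot_or_eq_top (R := K) (LieAlgebra.center K S) with h | h
  · simpa [h] using this
  · exact absurd ((LieAlgebra.isLieAbelian_iff_center_eq_top K S).2 h)
      (IsSimple.non_abelian (R := K))

section Centroid

variable {K S : Type*} [Field K] [LieRing S] [LieAlgebra K S]

theorem centroid_lie_right (θ : centroid K S) (x y : S) : θ • ⁅x, y⁆ = ⁅x, θ • y⁆ := θ.2 x y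

theorem centroid_lie_left (θ : centroid K S) (x y : S) : θ • ⁅x, y⁆ = ⁅θ • x, y⁆ := by
  rw [← lie_skew, smul_neg, centroid_lie_right, lie_skew]

/-- Both ab[x, y] and ba[x, y] equal [ax, by], so (ab − ba)x is central, hence zero. Inverses follow
as in Schur's lemma: kernels and images are ideals. -/
theorem isField_centroid [IsSimple K S] : IsField (centroid K S) where
  exists_pair_ne := by
    obtain ⟨x, hx⟩ := @exists_ne _ (IsSimple.nontrivial K S) (0 : S)
    exact ⟨0, 1, fun h => hx (by simpa using congrArg (fun θ : centroid K S => θ • x) h.symm)⟩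
  mul_comm a b := by
    have h (x y : S) : ⁅(a * b - b * a) • x, y⁆ = 0 := by
      rw [← centroid_lie_left, sub_smul, mul_smul, mul_smul, centroid_lie_right b,
        centroid_lie_left a, centroid_lie_left a, centroid_lie_right b, sub_self]
    rw [← sub_eq_zero]
    ext x
    exact IsSimple.eq_zero_of_forall_lie_eq_zero (K := K) _ (h x)
  mul_inv_cancel {a} ha := by
    let I : LieIdeal K S := { LinearMap.ker a.1 with
      lie_mem := by
        intro x y hy
        change a • ⁅x, y⁆ = 0
        rw [centroid_lie_right, show a • y = 0 from hy, lie_zero] }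
    let J : LieIdeal K S := { LinearMap.range a.1 with
      lie_mem := by
        rintro x _ ⟨y, rfl⟩
        exact ⟨⁅x, y⁆, a.2 x y⟩ }
    have hne : ∃ x : S, a • x ≠ 0 := by
      by_contra! h
      exact ha (by ext x; exact h x)
    obtain ⟨x, hx⟩ := hne
    have hI : I = ⊥ := (IsSimple.eq_bot_or_eq_top (R := K) I).resolve_right fun h =>
      hx (show x ∈ I by rw [h]; trivial)
    have hJ : J = ⊤ := (IsSimple.eq_bot_or_eq_top (R := K) J).resolve_left fun h =>
      hx (by
        have : a • x ∈ J := ⟨x, rfl⟩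
        simpa [h] using this)
    have hinj : Function.Injective a.1 := by
      rw [← LinearMap.ker_eq_bot, Submodule.eq_bot_iff]
      intro y hy
      have : y ∈ I := hy
      simpa [hI] using this
    have hsurj : Function.Surjective a.1 := fun y => by
      have : y ∈ J := by rw [hJ]; trivial
      exact this
    let e := LinearEquiv.ofBijective a.1 ⟨hinj, hsurj⟩
    refine ⟨⟨e.symm.toLinearMap, fun x y => ?_⟩, ?_⟩
    · apply e.injective
      change e (e.symm _) = a.1 _
      rw [a.2]
      change e (e.symm _) = ⁅x, e (e.symm _)⁆
      simp
    · ext x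
      exact e.apply_symm_apply x

noncomputable instance [IsSimple K S] : Field (centroid K S) := (isField_centroid).toField

instance [IsSimple K S] : LieAlgebra (centroid K S) S where
  lie_smul θ x y := (centroid_lie_right θ x y).symm

end Centroid

/-- By the density theorem, the multiplication algebra of a simple Lie algebra of finite dimension
over its centroid consists of all linear endomorphisms over the centroid. -/
theorem freeAd_surjective_of_isSimple {K G S : Type*} [Field K] [LieRing G] [LieAlgebra K G]
    [LieRing S] [LieAlgebra K S] [IsSimple K S] [FiniteDimensional (centroid K S) S]
    (p : G →ₗ[K] S) (hp : Function.Surjective p) :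
    Function.Surjective (freeAd (L := centroid K S) p) := by
  let R := (freeAd (L := centroid K S) p).range
  have hlie (x : S) : ∃ r : R, ∀ y : S, r • y = ⁅x, y⁆ := by
    obtain ⟨g, rfl⟩ := hp x
    refine ⟨⟨_, FreeAlgebra.ι K g, rfl⟩, fun y => ?_⟩
    change freeAd (L := centroid K S) p (FreeAlgebra.ι K g) y = _
    rw [freeAd_ι, ad_apply]
  have : Nontrivial S := IsSimple.nontrivial K S
  have : IsSimpleModule R S := (isSimpleModule_iff R S).2
    { eq_bot_or_eq_top := fun N => by
        let I : LieIdeal K S :=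
          { N with
            smul_mem' := fun c x hx => by
              have := N.smul_mem (algebraMap K R c) hx
              rwa [algebraMap_smul] at this
            lie_mem := fun {x y} hy => by
              obtain ⟨r, hr⟩ := hlie x
              rw [← hr]
              exact N.smul_mem r hy }
        refine (IsSimple.eq_bot_or_eq_top (R := K) I).imp (fun h => ?_) fun h => ?_
        · rw [eq_bot_iff]
          intro x hx
          have : x ∈ I := hx
          simpa [h] using this
        · rw [eq_top_iff]
          intro x _
          show x ∈ I
          rw [h]
          trivial }
  have hK (φ : End R S) (c : K) (x : S) : φ (c • x) = c • φ x := by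
    have h := φ.map_smul (algebraMap K R c) x
    rwa [algebraMap_smul, algebraMap_smul] at h
  have hφ (φ : End R S) (x y : S) : φ ⁅x, y⁆ = ⁅x, φ y⁆ := by
    obtain ⟨r, hr⟩ := hlie x
    rw [← hr, ← hr, φ.map_smul]
  intro T
  -- Endomorphisms over R commute with every ad x, so they lie in the centroid; hence T commutes
  -- with them and Jacobson density applies.
  let θ (φ : End R S) : centroid K S := ⟨⟨⟨φ, φ.map_add⟩, hK φ⟩, hφ φ⟩
  let f : End (End R S) S := ⟨⟨T, T.map_add⟩, fun φ x => T.map_smul (θ φ) x⟩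
  classical
  let b := finBasis (centroid K S) S
  obtain ⟨⟨_, u, rfl⟩, hr⟩ := jacobson_density f (Finset.univ.image b)
  exact ⟨u, b.ext fun j => (hr (b j) (by simp)).symm⟩

end LieAlgebra

theorem mainTheorem5 {K G : Type*} [Field K] [CharZero K] [LieRing G] [LieAlgebra K G]
    (hG : LieAlgebra.IsWeaklyNoetherian K G) (d : ℕ) (hd : 1 < d) :
    {m : LieIdeal K G | IsCoatom m ∧ LieAlgebra.IsSimple K (G ⧸ m) ∧
      Module.finrank (LieAlgebra.centroid K (G ⧸ m)) (G ⧸ m) = d}.Finite := by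
  rw [← Set.finite_coe_iff]
  set ι := {m : LieIdeal K G | IsCoatom m ∧ LieAlgebra.IsSimple K (G ⧸ m) ∧
      Module.finrank (LieAlgebra.centroid K (G ⧸ m)) (G ⧸ m) = d}
  have hsimple (m : ι) : LieAlgebra.IsSimple K (G ⧸ m.1) := m.2.2.1
  have hfin (m : ι) : Module.finrank (LieAlgebra.centroid K (G ⧸ m.1)) (G ⧸ m.1) = d := m.2.2.2
  have hfd (m : ι) : FiniteDimensional (LieAlgebra.centroid K (G ⧸ m.1)) (G ⧸ m.1) :=
    .of_finrank_pos (by rw [hfin]; omega)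
  let π (m : ι) : G →ₗ[K] G ⧸ m.1 := (LieSubmodule.Quotient.mk' m.1 : G →ₗ[K] G ⧸ m.1)
  have hsurj (m : ι) : Function.Surjective (π m) := LieSubmodule.Quotient.surjective_mk' m.1
  have hzero (m : ι) (g : G) : π m g = 0 ↔ g ∈ m.1 :=
    LieSubmodule.Quotient.mk_eq_zero _
  refine hG.finite_index (L := fun m : ι => LieAlgebra.centroid K (G ⧸ m.1)) (π := π)
    (d := d) (by omega) hfin hsurj (fun m x y => LieSubmodule.Quotient.mk_bracket _ x y)
    (fun m => LieAlgebra.freeAd_surjective_of_isSimple _ (hsurj m))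
    (fun m => LieAlgebra.IsSimple.eq_zero_of_forall_lie_eq_zero (K := K)) fun i k hki => ?_
  -- Distinct maximal ideals are incomparable, which supplies the separating element.
  have hle : ¬ k.1 ≤ i.1 := fun h => by
    rcases k.2.1.le_iff.1 h with h | h
    · exact i.2.1.1 h
    · exact hki (Subtype.ext h.symm)
  obtain ⟨g, hgk, hgi⟩ := SetLike.not_le_iff_exists.1 hle
  exact ⟨g, (hzero k g).2 hgk, fun h => hgi ((hzero i g).1 h)⟩
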